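/- For real $p,r$ let $A_0(p,r)=1$ and $A_k(p,r)=\frac{r}{k!}\prod_{i=1}^{k-1}(kp+r-i)$ for $k\ge 1$. The Fuss–Catalan distribution $\mu(p,r)$ is the probability measure on $\mathbb{R}$ whose $k$-th moment is $A_k(p,r)$ for all $k\ge 0$. A measure $\nu$ on $\mathbb{R}$ is called unimodal with mode $a\in\mathbb{R}$ if $\nu(\mathrm{d}x)=c\,\delta_a+f(x)\,\mathrm{d}x$ with $c\ge 0$ and $f\ge 0$ non-decreasing on $(-\infty,a)$ and non-increasing on $(a,\infty)$, and unimodal if this holds for some $a$. Let $p\ge 1$. Then $\mu(p,p-1)$ exists and is unique, and it is unimodal; its only mode is $0$. Moreover, if $p>1$, then $$\rho(\varphi)=\frac{(\sin p\varphi)^p}{\sin\varphi\,(\sin (p-1)\varphi)^{p-1}}$$ is a strictly decreasing map of $(0,\pi/p)$ onto $(0,\,p^p(p-1)^{1-p})$, the measure $\mu(p,p-1)$ has a density $W\ge 0$ with respect to Lebesgue measure that vanishes outside $(0,\,p^p(p-1)^{1-p})$ and satisfies $$W(\rho(\varphi))=\frac{1}{\pi\left(\cot((p-1)\varphi)+\cot\varphi\right)},\qquad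 0<\varphi<\frac{\pi}{p},$$ and the right-hand side is strictly increasing in $\varphi\in(0,\pi/p)$. -/

import Mathlib

open MeasureTheory Set
open scoped NNReal ENNReal

namespace FussCatalan

/-- The Fuss-Catalan (Raney) numbers `A_k(p,r) = (r / k!) ∏_{i=1}^{k-1} (k p + r - i)` for `k ≥ 1`,
with `A_0(p,r) = 1`. -/
noncomputable def number (p r : ℝ) (k : ℕ) : ℝ :=
  if k = 0 then 1
  else r / (Nat.factorial k : ℝ) * ∏ i ∈ Finset.Icc 1 (k - 1), ((k : ℝ) * p + r - (i : ℝ))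

/-- `μ` is the Fuss-Catalan distribution `μ(p,r)`: the probability measure on `ℝ` that has finite
moments of all orders and whose `k`-th moment is `A_k(p,r)` for every `k`. -/
structure IsDistribution (p r : ℝ) (μ : Measure ℝ) : Prop where
  isProbabilityMeasure : IsProbabilityMeasure μ
  integrable_pow : ∀ k : ℕ, Integrable (fun x : ℝ => x ^ k) μ
  moment_eq : ∀ k : ℕ, ∫ x, x ^ k ∂μ = number p r k

/-- The parametrization
`ρ(φ) = (sin (p φ))^p / (sin φ · (sin ((p-1) φ))^(p-1))`, used for `0 < φ < π / p`, where all three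
sines are positive. -/
noncomputable def rho (p φ : ℝ) : ℝ :=
  Real.sin (p * φ) ^ p / (Real.sin φ * Real.sin ((p - 1) * φ) ^ (p - 1))

/-- The right endpoint `p^p (p-1)^(1-p)` of the support, for `p > 1`. -/
noncomputable def rightEndpoint (p : ℝ) : ℝ := p ^ p * (p - 1) ^ (1 - p)

end FussCatalan

/-- A measure `ν` on `ℝ` is unimodal with mode `a`: `ν(dx) = c δ_a + f(x) dx` with `c ≥ 0` and
a density `f ≥ 0` that is non-decreasing on `(-∞, a)` and non-increasing on `(a, ∞)`
(so that `f` is automatically Borel measurable). -/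
def IsUnimodalWithMode (ν : Measure ℝ) (a : ℝ) : Prop :=
  ∃ (c : ℝ≥0) (f : ℝ → ℝ), (∀ x, 0 ≤ f x) ∧ MonotoneOn f (Iio a) ∧ AntitoneOn f (Ioi a) ∧
    ν = (c : ℝ≥0∞) • Measure.dirac a + volume.withDensity (fun x => ENNReal.ofReal (f x))

/-- A measure on `ℝ` is unimodal if it is unimodal with some mode. -/
def IsUnimodal (ν : Measure ℝ) : Prop := ∃ a : ℝ, IsUnimodalWithMode ν a

/-! For `p > 1` the density comes from a parametrized curve. In the triangle with vertices `0`, `1`,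
`w` where `w` has argument `φ` and `w - 1` has argument `p φ`, the law of sines gives `|w|` and `|w
- 1|`, and `w ^ p / (w - 1)` is the positive real number `x = ρ(φ)`. As `φ` runs from `0` to `π /
p`, the point `w` moves in the upper half plane from `p / (p - 1)` to `0`. The claimed density is
`W(x) = Im (w ^ (p - 1)) / (π x)`.

Since `dx / x = (p / w - 1 / (w - 1)) dw`, the form `x ^ k W(x) dx` is `1 / π` times the imaginary
part of a combination of `w ^ s / (w - 1) ^ m dw`. These forms have primitives whose imaginary parts
vanish on the real axis beyond `1` and tend at `0` to `π` times the residue at `1`, a binomial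
coefficient. The two binomials combine to `A_k(p, p - 1)`; see `exists_primitive_cpow_div`,
`primitiveLimit_sub_eq_number`, `integral_param_moment`.

Unimodality follows by monotonicity: `ρ` decreases (`rhoLogDeriv_neg`) and `W ∘ ρ` increases because
cotangent decreases, so `W` decreases on its support. Moments of exponential growth determine the
measure through its moment generating function (`IsDistribution.eq_of_number_le`). For `p = 1` the
measure is `δ_0`. -/

open Filter Topology

namespace FussCatalan

/-! ### Primitives of `w ^ s / (w - 1) ^ m` and their boundary values -/

/-- The open upper half plane together with the positive real axis. -/
def slitHalfPlane : Set ℂ := {w | 0 < w.im ∨ (w.im = 0 ∧ 0 < w.re)}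

lemma convex_slitHalfPlane : Convex ℝ slitHalfPlane := by
  intro x hx y hy a b ha hb hab
  simp only [slitHalfPlane, mem_ofPred_eq, Complex.add_im, Complex.real_smul, Complex.mul_im,
    Complex.ofReal_re, Complex.ofReal_im, zero_mul, add_zero, Complex.add_re, Complex.mul_re,
    sub_zero] at *
  rcases ha.eq_or_lt with rfl | ha
  · obtain rfl : b = 1 := by linarith
    simpa using hy
  rcases hb.eq_or_lt with rfl | hb
  · obtain rfl : a = 1 := by linarith
    simpa using hx
  rcases hx with hx | hx <;> rcases hy with hy | hy
  · left; positivity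
  · left; rw [hy.1]; simp; positivity
  · left; rw [hx.1]; simp; positivity
  · right; rw [hx.1, hy.1]; refine ⟨by simp, ?_⟩
    have := mul_pos ha hx.2
    have := mul_pos hb hy.2
    linarith

lemma slitHalfPlane_subset : slitHalfPlane ⊆ Complex.slitPlane := by
  rintro w (h | h)
  · exact Or.inr h.ne'
  · exact Or.inl h.2

lemma isOpen_upper : IsOpen {w : ℂ | 0 < w.im} := isOpen_lt continuous_const Complex.continuous_im

lemma upper_subset : {w : ℂ | 0 < w.im} ⊆ slitHalfPlane := fun _ h => Or.inl h

lemma ofReal_mem_slitHalfPlane {x : ℝ} (hx : 0 < x) : (x : ℂ) ∈ slitHalfPlane := by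
  right; simp [hx]

lemma sub_one_ne_zero_of_im_pos {w : ℂ} (hw : 0 < w.im) : w - 1 ≠ 0 := by
  intro h
  have := congrArg Complex.im h
  simp at this
  linarith

/-- The divided difference removes the singularity at `1`, so a primitive exists across the whole
positive axis. -/
lemma differentiableOn_dslope_cpow (s : ℝ) :
    DifferentiableOn ℂ (dslope (fun w : ℂ => w ^ (s : ℂ)) 1) Complex.slitPlane := by
  rw [Complex.differentiableOn_dslope (Complex.isOpen_slitPlane.mem_nhds Complex.one_mem_slitPlane)]
  intro w hw
  exact ((hasDerivAt_id w).cpow_const hw).differentiableAt.differentiableWithinAt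

lemma dslope_cpow_of_ne (s : ℝ) {w : ℂ} (hw : w ≠ 1) :
    dslope (fun w : ℂ => w ^ (s : ℂ)) 1 w = (w ^ (s : ℂ) - 1) / (w - 1) := by
  rw [dslope_of_ne _ hw, slope_def_field]; simp

lemma dslope_cpow_ofReal_im (s : ℝ) {x : ℝ} (hx : 0 < x) :
    (dslope (fun w : ℂ => w ^ (s : ℂ)) 1 (x : ℂ)).im = 0 := by
  by_cases h : (x : ℂ) = 1
  · rw [h, dslope_same]
    have := ((hasDerivAt_id (1 : ℂ)).cpow_const (c := (s : ℂ)) Complex.one_mem_slitPlane).deriv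
    simp only [id] at this
    rw [this]
    simp
  · rw [dslope_cpow_of_ne s h, ← Complex.ofReal_cpow hx.le, ← Complex.ofReal_one,
      ← Complex.ofReal_sub, ← Complex.ofReal_sub, ← Complex.ofReal_div, Complex.ofReal_im]

lemma norm_dslope_cpow_le {s : ℝ} (hs : 0 < s) {w : ℂ} (hw : ‖w‖ ≤ 1 / 2) :
    ‖dslope (fun w : ℂ => w ^ (s : ℂ)) 1 w‖ ≤ 4 := by
  have h1 : 1 / 2 ≤ ‖w - 1‖ := by
    have := norm_sub_norm_le (1 : ℂ) w
    rw [norm_sub_rev] at this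
    simp at this; linarith
  have hne : w ≠ 1 := by rintro rfl; simp at h1; norm_num at h1
  rw [dslope_cpow_of_ne s hne, norm_div, div_le_iff₀ (by linarith)]
  have h2 : ‖w ^ (s : ℂ)‖ ≤ 1 := by
    rcases eq_or_ne w 0 with rfl | h0
    · rw [Complex.zero_cpow (by exact_mod_cast hs.ne')]; simp
    · rw [Complex.norm_cpow_of_ne_zero h0]
      simp only [Complex.ofReal_re, Complex.ofReal_im, mul_zero, Real.exp_zero, div_one]
      exact Real.rpow_le_one (norm_nonneg _) (by linarith) hs.le
  have := norm_sub_le (w ^ (s : ℂ)) 1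
  rw [norm_one] at this
  linarith

/-- `(w ^ s - 1) / (w - 1)` has a primitive on the upper half plane whose imaginary part tends to
`0` at all points of `[0, ∞)`. -/
lemma exists_primitive_cpow_sub_one_div {s : ℝ} (hs : 0 < s) : ∃ G : ℂ → ℂ,
    (∀ w : ℂ, 0 < w.im → HasDerivAt G ((w ^ (s : ℂ) - 1) / (w - 1)) w) ∧
    (∀ c : ℝ, 0 < c → Tendsto (fun w => (G w).im) (𝓝[{w | 0 < w.im}] (c : ℂ)) (𝓝 0)) ∧
    Tendsto (fun w => (G w).im) (𝓝[{w | 0 < w.im}] 0) (𝓝 0) := by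
  set g := dslope (fun w : ℂ => w ^ (s : ℂ)) 1 with hg
  obtain ⟨H, hH⟩ := convex_slitHalfPlane.exists_forall_hasDerivWithinAt
    ((differentiableOn_dslope_cpow s).mono slitHalfPlane_subset)
  rw [← hg] at hH
  obtain ⟨G, hG, hG1⟩ : ∃ G : ℂ → ℂ,
      (∀ a ∈ slitHalfPlane, HasDerivWithinAt G (g a) slitHalfPlane a) ∧ G 1 = 0 :=
    ⟨fun w => H w - H 1, fun a ha => (hH a ha).sub_const _, sub_self _⟩
  -- The integrand is real on the positive axis and `G 1 = 0`.
  have hreal : ∀ x : ℝ, 0 < x → (G x).im = 0 := by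
    have hd : ∀ x ∈ Ioi (0 : ℝ), HasDerivWithinAt (fun y : ℝ => (G y).im) 0 (Ioi 0) x := by
      intro x hx
      have h1 : HasDerivWithinAt (fun y : ℝ => G y) (g x) (Ioi 0) x := by
        have := (hG x (ofReal_mem_slitHalfPlane hx)).scomp x
          (Complex.ofRealCLM.hasDerivAt.hasDerivWithinAt (x := x) (s := Ioi 0))
          (fun y hy => ofReal_mem_slitHalfPlane hy)
        simpa using! this
      have h2 := (Complex.imCLM.hasFDerivAt (x := G x)).comp_hasDerivWithinAt x h1
      have h3 : Complex.imCLM (g x) = 0 := dslope_cpow_ofReal_im s hx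
      rw [h3] at h2
      exact h2
    intro x hx
    have := (convex_Ioi (0 : ℝ)).is_const_of_fderivWithin_eq_zero (𝕜 := ℝ)
      (f := fun y : ℝ => (G y).im) (x := x) (y := 1)
      (fun y hy => (hd y hy).differentiableWithinAt)
      (fun y hy => by
        have := (hd y hy).hasFDerivWithinAt.fderivWithin (isOpen_Ioi.uniqueDiffWithinAt hy)
        rw [this]; ext; simp)
      hx (by simp)
    rw [this]; simp [hG1]
  refine ⟨G, fun w hw => ?_, fun c hc => ?_, ?_⟩
  · have hne : w ≠ 1 := fun h => sub_one_ne_zero_of_im_pos hw (by rw [h, sub_self])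
    have := (hG w (Or.inl hw)).hasDerivAt
      (mem_of_superset (isOpen_upper.mem_nhds hw) upper_subset)
    rwa [hg, dslope_cpow_of_ne s hne] at this
  · have h1 := (hG c (ofReal_mem_slitHalfPlane hc)).continuousWithinAt.mono upper_subset
    have h2 := (Complex.continuous_im.tendsto _).comp h1.tendsto
    rw [hreal c hc] at h2
    exact h2
  -- The point `0` lies outside the domain of `G`, so `w` is compared with the positive real `‖w‖`,
  -- where `Im G` vanishes; the derivative is bounded by `4` on the segment between them.
  · have hb : ∀ᶠ w in 𝓝[{w : ℂ | 0 < w.im}] 0, ‖(G w).im‖ ≤ 8 * ‖w‖ := by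
      have h1 : ∀ᶠ w in 𝓝[{w : ℂ | 0 < w.im}] 0, ‖w‖ < 1 / 2 :=
        nhdsWithin_le_nhds (by
          have : Tendsto (fun w : ℂ => ‖w‖) (𝓝 0) (𝓝 ‖(0 : ℂ)‖) := continuous_norm.tendsto _
          rw [norm_zero] at this
          exact this.eventually (gt_mem_nhds (by norm_num)))
      filter_upwards [h1, self_mem_nhdsWithin] with w hw hwU
      have hpos : 0 < ‖w‖ := norm_pos_iff.2 (by rintro rfl; simp at hwU)
      have hconv : Convex ℝ (slitHalfPlane ∩ Metric.closedBall 0 (1 / 2)) :=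
        convex_slitHalfPlane.inter (convex_closedBall _ _)
      have := hconv.norm_image_sub_le_of_norm_hasDerivWithin_le (C := 4) (f := G) (f' := g)
        (x := (‖w‖ : ℂ)) (y := w)
        (fun z hz => (hG z hz.1).mono inter_subset_left)
        (fun z hz => norm_dslope_cpow_le hs (by simpa using hz.2))
        ⟨ofReal_mem_slitHalfPlane hpos, by simpa using hw.le⟩
        ⟨Or.inl hwU, by simpa using hw.le⟩
      have h3 : (G w).im = (G w - G ‖w‖).im := by
        rw [Complex.sub_im, hreal _ hpos, sub_zero]
      rw [h3]
      have h4 : ‖w - (‖w‖ : ℂ)‖ ≤ 2 * ‖w‖ := by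
        have := norm_sub_le w (‖w‖ : ℂ)
        simp at this; linarith
      calc ‖(G w - G ‖w‖).im‖ ≤ ‖G w - G ‖w‖‖ := Complex.abs_im_le_norm _
        _ ≤ 4 * ‖w - (‖w‖ : ℂ)‖ := this
        _ ≤ 8 * ‖w‖ := by linarith
    refine squeeze_zero_norm' hb ?_
    have : Tendsto (fun w : ℂ => 8 * ‖w‖) (𝓝 0) (𝓝 (8 * ‖(0 : ℂ)‖)) :=
      (continuous_const.mul continuous_norm).tendsto _
    rw [norm_zero, mul_zero] at this
    exact this.mono_left nhdsWithin_le_nhds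

/-- The value at `0` of `1 / π` times the imaginary part of the primitive of
`w ^ s / (w - 1) ^ m`. -/
noncomputable def primitiveLimit (s : ℝ) : ℕ → ℝ
  | 0 => 0
  | m + 1 => (∏ i ∈ Finset.range m, (s - i)) / (m.factorial : ℝ)

lemma tendsto_cpow_zero {s : ℝ} (hs : 0 < s) :
    Tendsto (fun w : ℂ => w ^ (s : ℂ)) (𝓝[{w | 0 < w.im}] 0) (𝓝 0) := by
  have := Complex.continuousAt_cpow_const_of_re_pos (z := 0) (w := (s : ℂ)) (by simp) (by simpa)
  have h := this.tendsto
  rw [Complex.zero_cpow (by exact_mod_cast hs.ne')] at h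
  exact h.mono_left nhdsWithin_le_nhds

lemma tendsto_cpow_ofReal (s : ℝ) {c : ℝ} (hc : 0 < c) :
    Tendsto (fun w : ℂ => w ^ (s : ℂ)) (𝓝[{w | 0 < w.im}] (c : ℂ)) (𝓝 ((c ^ s : ℝ) : ℂ)) := by
  rw [Complex.ofReal_cpow hc.le]
  exact ((continuousAt_cpow_const (Or.inl (by simpa))).tendsto).mono_left nhdsWithin_le_nhds

lemma tendsto_im_cpow_div_zero {s : ℝ} (hs : 0 < s) (m : ℕ) :
    Tendsto (fun w : ℂ => (w ^ (s : ℂ) / (w - 1) ^ m).im) (𝓝[{w | 0 < w.im}] 0) (𝓝 0) := by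
  have h1 : Tendsto (fun w : ℂ => (w - 1) ^ m) (𝓝[{w | 0 < w.im}] 0) (𝓝 ((0 - 1) ^ m)) :=
    (Continuous.tendsto (by fun_prop) _).mono_left nhdsWithin_le_nhds
  have h2 := (Complex.continuous_im.tendsto _).comp
    ((tendsto_cpow_zero hs).div h1 (pow_ne_zero _ (by norm_num)))
  simpa using! h2

lemma tendsto_im_cpow_div_ofReal (s : ℝ) (m : ℕ) {c : ℝ} (hc : 1 < c) :
    Tendsto (fun w : ℂ => (w ^ (s : ℂ) / (w - 1) ^ m).im) (𝓝[{w | 0 < w.im}] (c : ℂ)) (𝓝 0) := by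
  have h1 : Tendsto (fun w : ℂ => (w - 1) ^ m) (𝓝[{w | 0 < w.im}] (c : ℂ))
      (𝓝 (((c : ℂ) - 1) ^ m)) :=
    (Continuous.tendsto (by fun_prop) _).mono_left nhdsWithin_le_nhds
  have hne : (c : ℂ) - 1 ≠ 0 := by
    rw [sub_ne_zero]; exact_mod_cast hc.ne'
  have h2 := (Complex.continuous_im.tendsto _).comp
    ((tendsto_cpow_ofReal s (by linarith : 0 < c)).div h1 (pow_ne_zero _ hne))
  have h3 : (((c ^ s : ℝ) : ℂ) / ((c : ℂ) - 1) ^ m).im = 0 := by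
    have : (((c ^ s : ℝ) : ℂ) / ((c : ℂ) - 1) ^ m) = ((c ^ s / (c - 1) ^ m : ℝ) : ℂ) := by
      push_cast; rfl
    rw [this, Complex.ofReal_im]
  rw [h3] at h2
  exact h2

lemma hasDerivAt_cpow_upper (s : ℝ) {w : ℂ} (hw : 0 < w.im) :
    HasDerivAt (fun w : ℂ => w ^ (s : ℂ)) (s * w ^ ((s : ℂ) - 1)) w := by
  simpa using (hasDerivAt_id w).cpow_const (c := (s : ℂ)) (Or.inr hw.ne')

/-- Primitives of `w ^ s / (w - 1) ^ m` on the upper half plane and the imaginary parts of their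
boundary values. -/
lemma exists_primitive_cpow_div (m : ℕ) : ∀ s : ℝ, (m : ℝ) - 1 < s → ∃ P : ℂ → ℂ,
    (∀ w : ℂ, 0 < w.im → HasDerivAt P (w ^ (s : ℂ) / (w - 1) ^ m) w) ∧
    (∀ c : ℝ, 1 < c → Tendsto (fun w => (P w).im) (𝓝[{w | 0 < w.im}] (c : ℂ)) (𝓝 0)) ∧
    Tendsto (fun w => (P w).im) (𝓝[{w | 0 < w.im}] 0) (𝓝 (Real.pi * primitiveLimit s m)) := by
  induction m with
  | zero =>
    intro s hs
    have hs' : 0 < s + 1 := by simp at hs; linarith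
    have hre : ∀ w : ℂ, (w ^ ((s + 1 : ℝ) : ℂ) / ((s + 1 : ℝ) : ℂ)).im
        = (w ^ ((s + 1 : ℝ) : ℂ) / (w - 1) ^ 0).im / (s + 1) := by
      intro w; rw [Complex.div_ofReal_im]; simp
    refine ⟨fun w => w ^ ((s + 1 : ℝ) : ℂ) / ((s + 1 : ℝ) : ℂ), fun w hw => ?_, fun c hc => ?_, ?_⟩
    · have := (hasDerivAt_cpow_upper (s + 1) hw).div_const ((s + 1 : ℝ) : ℂ)
      convert! this using 1
      have : ((s + 1 : ℝ) : ℂ) ≠ 0 := by exact_mod_cast hs'.ne'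
      rw [mul_div_cancel_left₀ _ this]
      simp
    · simp only [hre]
      simpa using (tendsto_im_cpow_div_ofReal (s + 1) 0 hc).div_const (s + 1)
    · simp only [hre]
      simpa [primitiveLimit] using (tendsto_im_cpow_div_zero hs' 0).div_const (s + 1)
  | succ m ih =>
    rcases m with _ | m
    · intro s hs
      obtain ⟨G, hG, hGc, hG0⟩ := exists_primitive_cpow_sub_one_div (s := s) (by simpa using hs)
      -- Split off the pole: `w ^ s / (w - 1) = (w ^ s - 1) / (w - 1) + 1 / (w - 1)`. The logarithm
      -- alone contributes the value `π` at `0`.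
      refine ⟨fun w => G w + Complex.log (w - 1), fun w hw => ?_, fun c hc => ?_, ?_⟩
      · have h1 := ((hasDerivAt_id w).sub_const 1).clog (Or.inr (by simpa using hw.ne'))
        have := (hG w hw).add h1
        convert! this using 1
        have := sub_one_ne_zero_of_im_pos hw
        simp only [id]
        field_simp
        ring
      · have h1 : Tendsto (fun w : ℂ => (Complex.log (w - 1)).im) (𝓝[{w | 0 < w.im}] (c : ℂ))
            (𝓝 0) := by
          have hct : ContinuousAt (fun w : ℂ => (Complex.log (w - 1)).im) (c : ℂ) := by
            refine Complex.continuous_im.continuousAt.comp ?_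
            refine ContinuousAt.clog (by fun_prop) (Or.inl ?_)
            simpa using hc
          have := hct.tendsto
          have h2 : (Complex.log ((c : ℂ) - 1)).im = 0 := by
            rw [Complex.log_im, Complex.arg_eq_zero_iff]
            simp; linarith
          rw [h2] at this
          exact this.mono_left nhdsWithin_le_nhds
        simpa using (hGc c (by linarith)).add h1
      · have h1 : Tendsto (fun w : ℂ => (Complex.log (w - 1)).im) (𝓝[{w | 0 < w.im}] 0)
            (𝓝 Real.pi) := by
          simp only [Complex.log_im]
          refine (Complex.tendsto_arg_nhdsWithin_im_nonneg_of_re_neg_of_im_zero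
            (z := -1) (by simp) (by simp)).comp ?_
          refine tendsto_nhdsWithin_iff.2 ⟨?_, ?_⟩
          · have : Tendsto (fun w : ℂ => w - 1) (𝓝 0) (𝓝 (0 - 1)) :=
              Continuous.tendsto (by fun_prop) _
            rw [zero_sub] at this
            exact this.mono_left nhdsWithin_le_nhds
          · filter_upwards [self_mem_nhdsWithin] with w hw
            simpa using (le_of_lt hw)
        simpa [primitiveLimit] using hG0.add h1
    · intro s hs
      push_cast at hs
      have hspos : 0 < s := by have : (0 : ℝ) ≤ m := Nat.cast_nonneg m; linarith
      obtain ⟨P, hP, hPc, hP0⟩ := ih (s - 1) (by push_cast; linarith)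
      set n : ℝ := (m : ℝ) + 1 with hn
      have hnpos : 0 < n := by positivity
      have him : ∀ w : ℂ, (((s / n : ℝ) : ℂ) * P w
          - w ^ (s : ℂ) / (w - 1) ^ (m + 1) / (n : ℂ)).im
          = s / n * (P w).im - (w ^ (s : ℂ) / (w - 1) ^ (m + 1)).im / n := by
        intro w
        rw [Complex.sub_im, Complex.div_ofReal_im, Complex.im_ofReal_mul]
      -- Integration by parts lowers the exponent and the pole order by one each, which preserves
      -- the condition on `s`. The boundary term has imaginary part tending to `0` at both ends.
      refine ⟨fun w => ((s / n : ℝ) : ℂ) * P w - w ^ (s : ℂ) / (w - 1) ^ (m + 1) / (n : ℂ),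
        fun w hw => ?_, fun c hc => ?_, ?_⟩
      · have h0 := sub_one_ne_zero_of_im_pos hw
        have hw0 : w ≠ 0 := by rintro rfl; simp at hw
        have h1 := ((hasDerivAt_id w).sub_const 1).pow (m + 1)
        have h2 := ((hasDerivAt_cpow_upper s hw).div h1 (pow_ne_zero _ h0)).div_const (n : ℂ)
        have := ((hP w hw).const_mul ((s / n : ℝ) : ℂ)).sub h2
        convert! this using 1
        have hnc : (n : ℂ) ≠ 0 := by exact_mod_cast hnpos.ne'
        have e1 : w ^ (s : ℂ) = w * w ^ ((s : ℂ) - 1) := by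
          rw [Complex.cpow_sub _ _ hw0, Complex.cpow_one]; field_simp
        have e2 : ((s - 1 : ℝ) : ℂ) = (s : ℂ) - 1 := by push_cast; rfl
        have e3 : (n : ℂ) = m + 1 := by rw [hn]; push_cast; rfl
        rw [e2]
        simp only [id, Nat.add_sub_cancel, mul_one, Complex.ofReal_div, Pi.pow_apply,
          Nat.cast_add, Nat.cast_one, ← e3]
        field_simp
        ring
      · simp only [him]
        simpa using ((hPc c hc).const_mul (s / n)).sub
          ((tendsto_im_cpow_div_ofReal s (m + 1) hc).div_const n)
      · simp only [him]
        have := (hP0.const_mul (s / n)).sub ((tendsto_im_cpow_div_zero hspos (m + 1)).div_const n)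
        convert this using 2
        simp only [primitiveLimit]
        rw [Finset.prod_range_succ', Nat.factorial_succ]
        have : ∀ i ∈ Finset.range m, s - ((i + 1 : ℕ) : ℝ) = s - 1 - i := by
          intro i _; push_cast; ring
        rw [Finset.prod_congr rfl this]
        push_cast
        rw [← hn]
        field_simp
        ring

/-! ### Raney numbers as a difference of binomials -/

/-- For `k ≥ 1`, with `B` the binomial of `k p + r - 1` over `k - 1`, the difference is `((k p + r)
/ k) B - p B = (r / k) B`. -/
lemma primitiveLimit_sub_eq_number (p r : ℝ) (k : ℕ) :
    primitiveLimit (k * p + r) (k + 1) - p * primitiveLimit (k * p + r - 1) k = number p r k := by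
  rcases k with _ | k
  · simp [primitiveLimit, number]
  · simp only [primitiveLimit, number, Nat.add_sub_cancel, Nat.succ_ne_zero, if_false]
    rw [Finset.prod_range_succ', Nat.factorial_succ, Finset.range_eq_Ico,
      Finset.prod_Ico_add' (fun i : ℕ => ((k + 1 : ℕ) : ℝ) * p + r - i) 0 k 1]
    have h1 : ∏ i ∈ Finset.Ico 0 k, (((k + 1 : ℕ) : ℝ) * p + r - 1 - i)
        = ∏ i ∈ Finset.Ico (0 + 1) (k + 1), (((k + 1 : ℕ) : ℝ) * p + r - i) := by
      rw [← Finset.prod_Ico_add' (fun i : ℕ => ((k + 1 : ℕ) : ℝ) * p + r - i) 0 k 1]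
      refine Finset.prod_congr rfl fun i _ => ?_
      push_cast; ring
    have h2 : Finset.Icc 1 k = Finset.Ico (0 + 1) (k + 1) := by
      ext; simp
    rw [h1, h2]
    have : (k.factorial : ℝ) ≠ 0 := by positivity
    push_cast
    field_simp
    ring

/-! ### Monotonicity and range of `rho`, monotonicity of the parametrized density -/

section Sines

variable {p φ : ℝ}

lemma sin_pos_of_mem (hp : 1 < p) (h : φ ∈ Ioo 0 (Real.pi / p)) : 0 < Real.sin φ := by
  have hp0 : 0 < p := by linarith
  refine Real.sin_pos_of_pos_of_lt_pi h.1 (h.2.trans_le ?_)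
  exact div_le_self Real.pi_pos.le hp.le

lemma sin_mul_pos_of_mem (hp : 1 < p) (h : φ ∈ Ioo 0 (Real.pi / p)) : 0 < Real.sin (p * φ) := by
  have hp0 : 0 < p := by linarith
  refine Real.sin_pos_of_pos_of_lt_pi (mul_pos hp0 h.1) ?_
  have := (lt_div_iff₀ hp0).1 h.2
  linarith

lemma sub_one_mul_mem (hp : 1 < p) (h : φ ∈ Ioo 0 (Real.pi / p)) :
    (p - 1) * φ ∈ Ioo 0 Real.pi := by
  have hp0 : 0 < p := by linarith
  refine ⟨mul_pos (by linarith) h.1, ?_⟩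
  have := (lt_div_iff₀ hp0).1 h.2
  have := h.1
  linarith

lemma sin_sub_one_mul_pos_of_mem (hp : 1 < p) (h : φ ∈ Ioo 0 (Real.pi / p)) :
    0 < Real.sin ((p - 1) * φ) :=
  Real.sin_pos_of_mem_Ioo (sub_one_mul_mem hp h)

lemma mem_Ioo_pi (hp : 1 < p) (h : φ ∈ Ioo 0 (Real.pi / p)) : φ ∈ Ioo 0 Real.pi :=
  ⟨h.1, h.2.trans_le (div_le_self Real.pi_pos.le hp.le)⟩

lemma cot_add_cot_eq (hp : 1 < p) (h : φ ∈ Ioo 0 (Real.pi / p)) :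
    Real.cot ((p - 1) * φ) + Real.cot φ
      = Real.sin (p * φ) / (Real.sin φ * Real.sin ((p - 1) * φ)) := by
  have h1 := (sin_pos_of_mem hp h).ne'
  have h2 := (sin_sub_one_mul_pos_of_mem hp h).ne'
  have h3 : p * φ = (p - 1) * φ + φ := by ring
  rw [Real.cot_eq_cos_div_sin, Real.cot_eq_cos_div_sin, h3, Real.sin_add]
  field_simp
  ring

lemma cot_strictAntiOn : StrictAntiOn Real.cot (Ioo 0 Real.pi) := by
  intro a ha b hb hab
  have h1 := Real.sin_pos_of_mem_Ioo ha
  have h2 := Real.sin_pos_of_mem_Ioo hb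
  rw [Real.cot_eq_cos_div_sin, Real.cot_eq_cos_div_sin, div_lt_div_iff₀ h2 h1]
  have := Real.sin_pos_of_pos_of_lt_pi (sub_pos.2 hab) (by linarith [ha.1, hb.2])
  rw [Real.sin_sub] at this
  linarith

/-- The density of `μ(p, p - 1)` in terms of the parameter `φ`. -/
noncomputable def paramDensity (p φ : ℝ) : ℝ :=
  1 / (Real.pi * (Real.cot ((p - 1) * φ) + Real.cot φ))

lemma cot_add_cot_pos (hp : 1 < p) (h : φ ∈ Ioo 0 (Real.pi / p)) :
    0 < Real.cot ((p - 1) * φ) + Real.cot φ := by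
  rw [cot_add_cot_eq hp h]
  have h1 := sin_pos_of_mem hp h
  have h2 := sin_sub_one_mul_pos_of_mem hp h
  have h3 := sin_mul_pos_of_mem hp h
  positivity

lemma paramDensity_pos (hp : 1 < p) (h : φ ∈ Ioo 0 (Real.pi / p)) : 0 < paramDensity p φ :=
  one_div_pos.2 (mul_pos Real.pi_pos (cot_add_cot_pos hp h))

lemma paramDensity_strictMonoOn (hp : 1 < p) :
    StrictMonoOn (paramDensity p) (Ioo 0 (Real.pi / p)) := by
  intro a ha b hb hab
  refine one_div_lt_one_div_of_lt (mul_pos Real.pi_pos (cot_add_cot_pos hp hb)) ?_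
  refine mul_lt_mul_of_pos_left (add_lt_add ?_ ?_) Real.pi_pos
  · exact cot_strictAntiOn (sub_one_mul_mem hp ha) (sub_one_mul_mem hp hb)
      (mul_lt_mul_of_pos_left hab (by linarith))
  · exact cot_strictAntiOn (mem_Ioo_pi hp ha) (mem_Ioo_pi hp hb) hab

lemma rho_pos (hp : 1 < p) (h : φ ∈ Ioo 0 (Real.pi / p)) : 0 < rho p φ := by
  have h1 := sin_pos_of_mem hp h
  have h2 := sin_sub_one_mul_pos_of_mem hp h
  have h3 := sin_mul_pos_of_mem hp h
  unfold rho
  positivity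

/-- The logarithmic derivative of `rho`. -/
noncomputable def rhoLogDeriv (p φ : ℝ) : ℝ :=
  p ^ 2 * Real.cot (p * φ) - Real.cot φ - (p - 1) ^ 2 * Real.cot ((p - 1) * φ)

lemma hasDerivAt_log_sin_mul (c : ℝ) (h : Real.sin (c * φ) ≠ 0) :
    HasDerivAt (fun x => Real.log (Real.sin (c * x))) (c * Real.cot (c * φ)) φ := by
  have := (((hasDerivAt_id φ).const_mul c).sin).log h
  convert! this using 1
  simp [Real.cot_eq_cos_div_sin]
  ring

lemma hasDerivAt_rho (hp : 1 < p) (h : φ ∈ Ioo 0 (Real.pi / p)) :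
    HasDerivAt (rho p) (rho p φ * rhoLogDeriv p φ) φ := by
  have hexp : ∀ x ∈ Ioo 0 (Real.pi / p), Real.exp (p * Real.log (Real.sin (p * x))
      - Real.log (Real.sin (1 * x)) - (p - 1) * Real.log (Real.sin ((p - 1) * x))) = rho p x := by
    intro x hx
    have h1 := sin_pos_of_mem hp hx
    have h2 := sin_sub_one_mul_pos_of_mem hp hx
    have h3 := sin_mul_pos_of_mem hp hx
    rw [Real.exp_sub, Real.exp_sub, one_mul, Real.exp_log h1, rho, Real.rpow_def_of_pos h3,
      Real.rpow_def_of_pos h2, div_div, mul_comm p (Real.log _), mul_comm (p - 1) (Real.log _)]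
  have h1 := ((hasDerivAt_log_sin_mul (φ := φ) p (sin_mul_pos_of_mem hp h).ne').const_mul p).sub
    (hasDerivAt_log_sin_mul (φ := φ) 1 (by simpa using (sin_pos_of_mem hp h).ne'))
  have h2 := (h1.sub ((hasDerivAt_log_sin_mul (φ := φ) (p - 1)
    (sin_sub_one_mul_pos_of_mem hp h).ne').const_mul (p - 1))).exp
  have h3 := h2.congr_of_eventuallyEq (f₁ := rho p) (by
    filter_upwards [Ioo_mem_nhds h.1 h.2] with x hx using (hexp x hx).symm)
  convert! h3 using 1
  rw [← hexp φ h, rhoLogDeriv]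
  simp
  ring

/-- With `x = cot ((p - 1) φ)` and `y = cot φ`, the addition formula expresses `cot (p φ)` as `(x y
- 1) / (x + y)`. Multiplying by `x + y > 0` then turns the logarithmic derivative into minus a sum
of squares. -/
lemma rhoLogDeriv_neg (hp : 1 < p) (h : φ ∈ Ioo 0 (Real.pi / p)) : rhoLogDeriv p φ < 0 := by
  have h1 := sin_pos_of_mem hp h
  have h2 := sin_sub_one_mul_pos_of_mem hp h
  have h3 := sin_mul_pos_of_mem hp h
  have hpos := cot_add_cot_pos hp h
  have hcot : Real.cot (p * φ) * (Real.cot ((p - 1) * φ) + Real.cot φ)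
      = Real.cot ((p - 1) * φ) * Real.cot φ - 1 := by
    rw [cot_add_cot_eq hp h]
    simp only [Real.cot_eq_cos_div_sin]
    have h4 : Real.cos (p * φ) = Real.cos ((p - 1) * φ + φ) := by ring_nf
    rw [Real.cos_add] at h4
    rw [h4]
    generalize (p - 1) * φ = b at *
    field_simp
  set x := Real.cot ((p - 1) * φ)
  set y := Real.cot φ
  have : rhoLogDeriv p φ * (x + y) = -((p - 1) * x - y) ^ 2 - p ^ 2 := by
    rw [rhoLogDeriv]
    linear_combination p ^ 2 * hcot
  have h5 : rhoLogDeriv p φ * (x + y) < 0 := by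
    rw [this]
    nlinarith [sq_nonneg ((p - 1) * x - y)]
  exact neg_of_mul_neg_left h5 hpos.le

lemma rho_strictAntiOn (hp : 1 < p) : StrictAntiOn (rho p) (Ioo 0 (Real.pi / p)) := by
  refine strictAntiOn_of_deriv_neg (convex_Ioo _ _)
    (fun x hx => (hasDerivAt_rho hp hx).continuousAt.continuousWithinAt) fun x hx => ?_
  rw [interior_Ioo] at hx
  rw [(hasDerivAt_rho hp hx).deriv]
  exact mul_neg_of_pos_of_neg (rho_pos hp hx) (rhoLogDeriv_neg hp hx)

lemma tendsto_sin_mul_div (c : ℝ) :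
    Tendsto (fun φ => Real.sin (c * φ) / φ) (𝓝[>] 0) (𝓝 c) := by
  have h := ((hasDerivAt_id (0 : ℝ)).const_mul c).sin
  simp only [id, mul_zero, Real.cos_zero, one_mul, mul_one] at h
  have := (hasDerivAt_iff_tendsto_slope.1 h).mono_left
    (nhdsWithin_mono 0 (fun x (hx : 0 < x) => hx.ne'))
  refine this.congr fun x => ?_
  simp [slope_def_field]

lemma pi_div_pos (hp : 1 < p) : 0 < Real.pi / p := div_pos Real.pi_pos (by linarith)

lemma tendsto_rho_left (hp : 1 < p) :
    Tendsto (rho p) (𝓝[>] 0) (𝓝 (rightEndpoint p)) := by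
  have hp1 : 0 < p - 1 := by linarith
  have h1 := (tendsto_sin_mul_div p).rpow_const (p := p) (Or.inl (by linarith))
  have h2 := (tendsto_sin_mul_div (p - 1)).rpow_const (p := p - 1) (Or.inl hp1.ne')
  have h3 := h1.div ((tendsto_sin_mul_div 1).mul h2)
    (mul_ne_zero one_ne_zero (Real.rpow_pos_of_pos hp1 _).ne')
  have h4 : p ^ p / (1 * (p - 1) ^ (p - 1)) = rightEndpoint p := by
    rw [rightEndpoint, one_mul, div_eq_mul_inv, ← Real.rpow_neg hp1.le, neg_sub]
  rw [h4] at h3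
  refine h3.congr' ?_
  filter_upwards [Ioo_mem_nhdsGT (pi_div_pos hp)] with x hx
  have hx0 := hx.1
  have s3 := sin_mul_pos_of_mem hp hx
  have s2 := sin_sub_one_mul_pos_of_mem hp hx
  have s1 := sin_pos_of_mem hp hx
  simp only [Pi.div_apply, one_mul, rho]
  rw [Real.div_rpow s3.le hx0.le, Real.div_rpow s2.le hx0.le]
  have e : x ^ p = x * x ^ (p - 1) := by
    rw [Real.rpow_sub_one hx0.ne']; field_simp
  have := Real.rpow_pos_of_pos hx0 (p - 1)
  have := Real.rpow_pos_of_pos s2 (p - 1)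
  rw [e]
  field_simp

lemma sin_sub_one_mul_pi_div_pos (hp : 1 < p) : 0 < Real.sin ((p - 1) * (Real.pi / p)) := by
  have hp0 : 0 < p := by linarith
  refine Real.sin_pos_of_pos_of_lt_pi (mul_pos (by linarith) (pi_div_pos hp)) ?_
  rw [sub_mul, mul_div_cancel₀ _ hp0.ne']
  linarith [pi_div_pos hp]

lemma sin_pi_div_pos (hp : 1 < p) : 0 < Real.sin (Real.pi / p) :=
  Real.sin_pos_of_pos_of_lt_pi (pi_div_pos hp) (div_lt_self Real.pi_pos hp)

lemma tendsto_rho_right (hp : 1 < p) :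
    Tendsto (rho p) (𝓝[<] (Real.pi / p)) (𝓝 0) := by
  have hp0 : 0 < p := by linarith
  have hs1 := sin_pi_div_pos hp
  have hs2 := sin_sub_one_mul_pi_div_pos hp
  have hc : ContinuousAt (rho p) (Real.pi / p) := by
    unfold rho
    refine ContinuousAt.div ?_ ?_ ?_
    · exact ContinuousAt.rpow_const (by fun_prop) (Or.inr hp0.le)
    · exact ContinuousAt.mul (by fun_prop) (ContinuousAt.rpow_const (by fun_prop) (Or.inl hs2.ne'))
    · exact (mul_pos hs1 (Real.rpow_pos_of_pos hs2 _)).ne'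
  have h0 : rho p (Real.pi / p) = 0 := by
    rw [rho, mul_div_cancel₀ _ hp0.ne', Real.sin_pi, Real.zero_rpow hp0.ne', zero_div]
  have := hc.tendsto
  rw [h0] at this
  exact this.mono_left nhdsWithin_le_nhds

lemma rho_lt_rightEndpoint (hp : 1 < p) (h : φ ∈ Ioo 0 (Real.pi / p)) :
    rho p φ < rightEndpoint p := by
  have h2 : φ / 2 ∈ Ioo 0 (Real.pi / p) := ⟨half_pos h.1, (half_lt_self h.1).trans h.2⟩
  refine (rho_strictAntiOn hp h2 h (half_lt_self h.1)).trans_le ?_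
  refine ge_of_tendsto (tendsto_rho_left hp) ?_
  filter_upwards [Ioo_mem_nhdsGT h2.1] with x hx
  exact (rho_strictAntiOn hp ⟨hx.1, hx.2.trans h2.2⟩ h2 hx.2).le

lemma rho_image (hp : 1 < p) :
    rho p '' Ioo 0 (Real.pi / p) = Ioo 0 (rightEndpoint p) := by
  refine Subset.antisymm ?_ ?_
  · rintro _ ⟨φ, h, rfl⟩
    exact ⟨rho_pos hp h, rho_lt_rightEndpoint hp h⟩
  · have hne := pi_div_pos hp
    exact isPreconnected_Ioo.intermediate_value_Ioo (l₁ := 𝓝[<] (Real.pi / p)) (l₂ := 𝓝[>] 0)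
      (le_principal_iff.2 (Ioo_mem_nhdsLT hne)) (le_principal_iff.2 (Ioo_mem_nhdsGT hne))
      (fun x hx => (hasDerivAt_rho hp hx).continuousAt.continuousWithinAt)
      (tendsto_rho_right hp) (tendsto_rho_left hp)

end Sines

/-! ### The curve on which `w ^ p / (w - 1)` is real -/

/-- The curve in the upper half plane on which `w ^ p / (w - 1)` is real and equals `rho p`. -/
noncomputable def curve (p φ : ℝ) : ℂ :=
  ((Real.sin (p * φ) / Real.sin ((p - 1) * φ) : ℝ) : ℂ) * Complex.exp ((φ : ℝ) * Complex.I)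

section Curve

variable {p φ : ℝ}

lemma curve_im_pos (hp : 1 < p) (h : φ ∈ Ioo 0 (Real.pi / p)) : 0 < (curve p φ).im := by
  have h1 := sin_pos_of_mem hp h
  have h2 := sin_sub_one_mul_pos_of_mem hp h
  have h3 := sin_mul_pos_of_mem hp h
  rw [curve, Complex.im_ofReal_mul, Complex.exp_ofReal_mul_I_im]
  positivity

/-- Law of sines in the triangle `0`, `1`, `w`, whose angle at `w` is `(p - 1) φ`. -/
lemma curve_sub_one (h : Real.sin ((p - 1) * φ) ≠ 0) :
    curve p φ - 1 = ((Real.sin φ / Real.sin ((p - 1) * φ) : ℝ) : ℂ) *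
      Complex.exp ((p * φ : ℝ) * Complex.I) := by
  have h1 : (p - 1) * φ = p * φ - φ := by ring
  have hsub := Real.sin_sub (p * φ) φ
  rw [← h1] at hsub
  have h0 := Real.sin_sq_add_cos_sq φ
  rw [curve]
  generalize (p - 1) * φ = b at *
  apply Complex.ext
  · rw [Complex.sub_re, Complex.re_ofReal_mul, Complex.re_ofReal_mul,
      Complex.exp_ofReal_mul_I_re, Complex.exp_ofReal_mul_I_re, Complex.one_re]
    field_simp
    rw [hsub]
    ring
  · rw [Complex.sub_im, Complex.im_ofReal_mul, Complex.im_ofReal_mul,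
      Complex.exp_ofReal_mul_I_im, Complex.exp_ofReal_mul_I_im, Complex.one_im]
    field_simp
    ring

lemma curve_cpow (hp : 1 < p) (h : φ ∈ Ioo 0 (Real.pi / p)) (s : ℝ) :
    curve p φ ^ (s : ℂ) = (((Real.sin (p * φ) / Real.sin ((p - 1) * φ)) ^ s : ℝ) : ℂ) *
      Complex.exp ((s * φ : ℝ) * Complex.I) := by
  have hr := div_pos (sin_mul_pos_of_mem hp h) (sin_sub_one_mul_pos_of_mem hp h)
  have hφ := mem_Ioo_pi hp h
  rw [curve]
  set R := Real.sin (p * φ) / Real.sin ((p - 1) * φ)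
  have hne : (R : ℂ) ≠ 0 := by exact_mod_cast hr.ne'
  rw [Complex.cpow_def_of_ne_zero (mul_ne_zero hne (Complex.exp_ne_zero _)),
    Complex.log_ofReal_mul hr (Complex.exp_ne_zero _),
    Complex.log_exp (by simp; linarith [hφ.1, Real.pi_pos]) (by simpa using hφ.2.le),
    Real.rpow_def_of_pos hr, add_mul, Complex.exp_add]
  push_cast
  ring_nf

lemma rho_eq_div (hp : 1 < p) (h : φ ∈ Ioo 0 (Real.pi / p)) :
    rho p φ = (Real.sin (p * φ) / Real.sin ((p - 1) * φ)) ^ p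
      / (Real.sin φ / Real.sin ((p - 1) * φ)) := by
  have h1 := sin_pos_of_mem hp h
  have h2 := sin_sub_one_mul_pos_of_mem hp h
  have h3 := sin_mul_pos_of_mem hp h
  have e : Real.sin ((p - 1) * φ) ^ p
      = Real.sin ((p - 1) * φ) * Real.sin ((p - 1) * φ) ^ (p - 1) := by
    rw [Real.rpow_sub_one h2.ne']; field_simp
  have := Real.rpow_pos_of_pos h2 (p - 1)
  rw [rho, Real.div_rpow h3.le h2.le, e]
  generalize Real.sin ((p - 1) * φ) = S at *
  field_simp

/-- Both `w ^ p` and `w - 1` have argument `p φ`, so the phases cancel and only the positive modulus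
`rho p φ` remains. -/
lemma curve_cpow_div (hp : 1 < p) (h : φ ∈ Ioo 0 (Real.pi / p)) (r : ℝ) (k : ℕ) :
    curve p φ ^ ((k * p + r : ℝ) : ℂ) / (curve p φ - 1) ^ k
      = ((rho p φ ^ k : ℝ) : ℂ) * curve p φ ^ (r : ℂ) := by
  have h1 := sin_pos_of_mem hp h
  have h2 := sin_sub_one_mul_pos_of_mem hp h
  have h3 := sin_mul_pos_of_mem hp h
  have hr := div_pos h3 h2
  have hq := div_pos h1 h2
  rw [curve_cpow hp h, curve_cpow hp h, curve_sub_one h2.ne', rho_eq_div hp h]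
  set R := Real.sin (p * φ) / Real.sin ((p - 1) * φ)
  set q := Real.sin φ / Real.sin ((p - 1) * φ)
  have e1 : R ^ ((k : ℝ) * p + r) = (R ^ p) ^ k * R ^ r := by
    rw [Real.rpow_add hr, mul_comm (k : ℝ) p, Real.rpow_mul hr.le, Real.rpow_natCast]
  have e2 : Complex.exp (((k * p + r) * φ : ℝ) * Complex.I)
      = Complex.exp ((p * φ : ℝ) * Complex.I) ^ k * Complex.exp ((r * φ : ℝ) * Complex.I) := by
    rw [← Complex.exp_nat_mul, ← Complex.exp_add]
    push_cast; ring_nf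
  have hqc : (q : ℂ) ≠ 0 := by exact_mod_cast hq.ne'
  have hE := Complex.exp_ne_zero ((p * φ : ℝ) * Complex.I)
  rw [e1, e2, div_pow, mul_pow]
  push_cast
  field_simp

lemma curve_cpow_im (hp : 1 < p) (h : φ ∈ Ioo 0 (Real.pi / p)) :
    (curve p φ ^ ((p - 1 : ℝ) : ℂ)).im = Real.pi * (rho p φ * paramDensity p φ) := by
  have h1 := sin_pos_of_mem hp h
  have h2 := sin_sub_one_mul_pos_of_mem hp h
  have h3 := sin_mul_pos_of_mem hp h
  have hr := div_pos h3 h2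
  rw [curve_cpow hp h, Complex.im_ofReal_mul, Complex.exp_ofReal_mul_I_im, paramDensity,
    cot_add_cot_eq hp h, rho_eq_div hp h, Real.rpow_sub_one hr.ne']
  have := Real.pi_pos
  field_simp

lemma hasDerivAt_sin_ratio_mul_exp (a b c : ℝ) (ha : Real.sin (a * φ) ≠ 0)
    (hb : Real.sin (b * φ) ≠ 0) :
    HasDerivAt (fun x : ℝ => ((Real.sin (a * x) / Real.sin (b * x) : ℝ) : ℂ) *
        Complex.exp ((c * x : ℝ) * Complex.I))
      (((Real.sin (a * φ) / Real.sin (b * φ) : ℝ) : ℂ) * Complex.exp ((c * φ : ℝ) * Complex.I) *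
        (a * Real.cot (a * φ) - b * Real.cot (b * φ) + c * Complex.I)) φ := by
  have h1 : HasDerivAt (fun x : ℝ => ((Real.sin (a * x) / Real.sin (b * x) : ℝ) : ℂ))
      (((Real.cos (a * φ) * a * Real.sin (b * φ) - Real.sin (a * φ) * (Real.cos (b * φ) * b))
        / Real.sin (b * φ) ^ 2 : ℝ) : ℂ) φ := by
    refine HasDerivAt.ofReal_comp (f := fun x => Real.sin (a * x) / Real.sin (b * x)) ?_
    simpa using! (((hasDerivAt_id φ).const_mul a).sin).div ((hasDerivAt_id φ).const_mul b).sin hb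
  have h2 : HasDerivAt (fun x : ℝ => Complex.exp ((c * x : ℝ) * Complex.I))
      (Complex.exp ((c * φ : ℝ) * Complex.I) * (c * Complex.I)) φ := by
    simpa using! ((((hasDerivAt_id φ).const_mul c).ofReal_comp).mul_const Complex.I).cexp
  have := h1.mul h2
  convert! this using 1
  simp only [Real.cot_eq_cos_div_sin]
  have hac : ((Real.sin (a * φ) : ℝ) : ℂ) ≠ 0 := by exact_mod_cast ha
  have hbc : ((Real.sin (b * φ) : ℝ) : ℂ) ≠ 0 := by exact_mod_cast hb
  generalize b * φ = v at *
  push_cast at hac hbc ⊢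
  field_simp

lemma hasDerivAt_curve (hp : 1 < p) (h : φ ∈ Ioo 0 (Real.pi / p)) :
    HasDerivAt (curve p) (curve p φ * (p * Real.cot (p * φ)
      - (p - 1 : ℝ) * Real.cot ((p - 1) * φ) + Complex.I)) φ := by
  have := hasDerivAt_sin_ratio_mul_exp (φ := φ) p (p - 1) 1 (sin_mul_pos_of_mem hp h).ne'
    (sin_sub_one_mul_pos_of_mem hp h).ne'
  simp only [one_mul, Complex.ofReal_one] at this
  exact this

/-- Both sides are the derivative of the curve, computed from the polar forms of `w` and of `w - 1`.
This yields `w' / w` and `w' / (w - 1)` explicitly. -/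
lemma curve_deriv_eq (hp : 1 < p) (h : φ ∈ Ioo 0 (Real.pi / p)) :
    curve p φ * (p * Real.cot (p * φ) - (p - 1 : ℝ) * Real.cot ((p - 1) * φ) + Complex.I)
      = (curve p φ - 1) * (Real.cot φ - (p - 1 : ℝ) * Real.cot ((p - 1) * φ)
        + p * Complex.I) := by
  have h1 := hasDerivAt_sin_ratio_mul_exp (φ := φ) 1 (p - 1) p
    (by simpa using (sin_pos_of_mem hp h).ne') (sin_sub_one_mul_pos_of_mem hp h).ne'
  simp only [one_mul, Complex.ofReal_one] at h1
  rw [← curve_sub_one (sin_sub_one_mul_pos_of_mem hp h).ne'] at h1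
  have h2 := h1.congr_of_eventuallyEq (f₁ := fun x => curve p x - 1) (by
    filter_upwards [Ioo_mem_nhds h.1 h.2] with x hx
    exact curve_sub_one (sin_sub_one_mul_pos_of_mem hp hx).ne')
  exact ((hasDerivAt_curve hp h).sub_const 1).unique h2

lemma tendsto_curve_left (hp : 1 < p) :
    Tendsto (curve p) (𝓝[>] 0) (𝓝[{w | 0 < w.im}] ((p / (p - 1) : ℝ) : ℂ)) := by
  refine tendsto_nhdsWithin_iff.2 ⟨?_, ?_⟩
  · have hp1 : p - 1 ≠ 0 := by linarith
    have h1 := (tendsto_sin_mul_div p).div (tendsto_sin_mul_div (p - 1)) hp1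
    have h2 : Tendsto (fun φ : ℝ => Complex.exp ((φ : ℝ) * Complex.I)) (𝓝[>] 0) (𝓝 1) := by
      have : Tendsto (fun φ : ℝ => Complex.exp ((φ : ℝ) * Complex.I)) (𝓝 0)
          (𝓝 (Complex.exp (((0 : ℝ) : ℂ) * Complex.I))) := Continuous.tendsto (by fun_prop) _
      simp only [Complex.ofReal_zero, zero_mul, Complex.exp_zero] at this
      exact this.mono_left nhdsWithin_le_nhds
    have h3 := ((Complex.continuous_ofReal.tendsto _).comp h1).mul h2
    rw [mul_one] at h3
    refine h3.congr' ?_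
    filter_upwards [self_mem_nhdsWithin] with x hx
    have hx : x ≠ 0 := ne_of_gt hx
    simp only [Function.comp, Pi.div_apply, curve]
    rw [div_div_div_cancel_right₀ hx]
  · filter_upwards [Ioo_mem_nhdsGT (pi_div_pos hp)] with x hx using curve_im_pos hp hx

lemma tendsto_curve_right (hp : 1 < p) :
    Tendsto (curve p) (𝓝[<] (Real.pi / p)) (𝓝[{w | 0 < w.im}] 0) := by
  have hp0 : 0 < p := by linarith
  refine tendsto_nhdsWithin_iff.2 ⟨?_, ?_⟩
  · have hc : ContinuousAt (curve p) (Real.pi / p) := by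
      unfold curve
      refine ContinuousAt.mul ?_ (by fun_prop)
      refine Complex.continuous_ofReal.continuousAt.comp ?_
      exact ContinuousAt.div (by fun_prop) (by fun_prop) (sin_sub_one_mul_pi_div_pos hp).ne'
    have h0 : curve p (Real.pi / p) = 0 := by
      rw [curve, mul_div_cancel₀ _ hp0.ne', Real.sin_pi]; simp
    have := hc.tendsto
    rw [h0] at this
    exact this.mono_left nhdsWithin_le_nhds
  · filter_upwards [Ioo_mem_nhdsLT (pi_div_pos hp)] with x hx using curve_im_pos hp hx

/-! ### Moments as boundary values of primitives -/

/-- The integrals over the parameter interval that give the moments. -/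
lemma integral_param_moment (hp : 1 < p) (k : ℕ) :
    IntegrableOn (fun φ => |rho p φ * rhoLogDeriv p φ| • (rho p φ ^ k * paramDensity p φ))
      (Ioo 0 (Real.pi / p)) ∧
    ∫ φ in Ioo 0 (Real.pi / p), |rho p φ * rhoLogDeriv p φ| • (rho p φ ^ k * paramDensity p φ)
      = number p (p - 1) k := by
  have hp0 : 0 < p := by linarith
  have hk : (0 : ℝ) ≤ k := Nat.cast_nonneg k
  have hkp : (k : ℝ) ≤ k * p := le_mul_of_one_le_right hk hp.le
  obtain ⟨P, hP, hPc, hP0⟩ := exists_primitive_cpow_div (k + 1) (k * p + (p - 1))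
    (by push_cast; linarith)
  obtain ⟨Q, hQ, hQc, hQ0⟩ := exists_primitive_cpow_div k (k * p + (p - 1) - 1) (by linarith)
  have hc : 1 < p / (p - 1) := by
    rw [one_lt_div (by linarith)]; linarith
  set F : ℝ → ℝ := fun φ => (1 / Real.pi) * ((P (curve p φ)).im - p * (Q (curve p φ)).im) with hF
  set f : ℝ → ℝ := fun φ => |rho p φ * rhoLogDeriv p φ| • (rho p φ ^ k * paramDensity p φ) with hf
  have hderiv : ∀ φ ∈ Ioo 0 (Real.pi / p), HasDerivAt F (f φ) φ := by
    intro φ h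
    have hw := curve_im_pos hp h
    have hw0 : curve p φ ≠ 0 := by intro h0; rw [h0] at hw; simp at hw
    have hw1 := sub_one_ne_zero_of_im_pos hw
    have hd := hasDerivAt_curve hp h
    have dP := (hP _ hw).comp φ hd
    have dQ := (hQ _ hw).comp φ hd
    have dPim := (Complex.imCLM.hasFDerivAt (x := P (curve p φ))).comp_hasDerivAt φ dP
    have dQim := (Complex.imCLM.hasFDerivAt (x := Q (curve p φ))).comp_hasDerivAt φ dQ
    have := (dPim.sub (dQim.const_mul p)).const_mul (1 / Real.pi)
    convert! this using 1
    simp only [Complex.imCLM_apply]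
    rw [← Complex.im_ofReal_mul, ← Complex.sub_im]
    have hsub : curve p φ ^ ((k * p + (p - 1) - 1 : ℝ) : ℂ)
        = curve p φ ^ ((k * p + (p - 1) : ℝ) : ℂ) / curve p φ := by
      rw [Complex.ofReal_sub, Complex.ofReal_one, Complex.cpow_sub _ _ hw0, Complex.cpow_one]
    -- Here `p w' / w - w' / (w - 1)` is the real number `rhoLogDeriv p φ`: the imaginary parts `p`
    -- cancel. The sign is negative because `rho` decreases.
    have key : curve p φ ^ ((k * p + (p - 1) : ℝ) : ℂ) / (curve p φ - 1) ^ (k + 1) *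
          (curve p φ * (p * Real.cot (p * φ) - (p - 1 : ℝ) * Real.cot ((p - 1) * φ) + Complex.I))
        - p * (curve p φ ^ ((k * p + (p - 1) - 1 : ℝ) : ℂ) / (curve p φ - 1) ^ k *
          (curve p φ * (p * Real.cot (p * φ) - (p - 1 : ℝ) * Real.cot ((p - 1) * φ) + Complex.I)))
        = ((-(rho p φ ^ k * rhoLogDeriv p φ) : ℝ) : ℂ) * curve p φ ^ ((p - 1 : ℝ) : ℂ) := by
      have e1 : curve p φ ^ ((k * p + (p - 1) : ℝ) : ℂ) / (curve p φ - 1) ^ (k + 1) *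
          (curve p φ * (p * Real.cot (p * φ) - (p - 1 : ℝ) * Real.cot ((p - 1) * φ) + Complex.I))
          = curve p φ ^ ((k * p + (p - 1) : ℝ) : ℂ) / (curve p φ - 1) ^ k *
            (Real.cot φ - (p - 1 : ℝ) * Real.cot ((p - 1) * φ) + p * Complex.I) := by
        rw [curve_deriv_eq hp h, pow_succ]
        field_simp
      have e2 : curve p φ ^ ((k * p + (p - 1) - 1 : ℝ) : ℂ) / (curve p φ - 1) ^ k *
          (curve p φ * (p * Real.cot (p * φ) - (p - 1 : ℝ) * Real.cot ((p - 1) * φ) + Complex.I))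
          = curve p φ ^ ((k * p + (p - 1) : ℝ) : ℂ) / (curve p φ - 1) ^ k *
            (p * Real.cot (p * φ) - (p - 1 : ℝ) * Real.cot ((p - 1) * φ) + Complex.I) := by
        rw [hsub]
        field_simp
      rw [e1, e2, curve_cpow_div hp h, rhoLogDeriv]
      push_cast
      ring
    rw [key, Complex.im_ofReal_mul, curve_cpow_im hp h, hf]
    simp only [smul_eq_mul]
    rw [abs_of_neg (mul_neg_of_pos_of_neg (rho_pos hp h) (rhoLogDeriv_neg hp h))]
    have := Real.pi_pos
    field_simp
  have hl : Tendsto F (𝓝[>] 0) (𝓝 0) := by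
    have := (((hPc _ hc).comp (tendsto_curve_left hp)).sub
      (((hQc _ hc).comp (tendsto_curve_left hp)).const_mul p)).const_mul (1 / Real.pi)
    rw [mul_zero, sub_zero, mul_zero] at this
    exact this
  have hr : Tendsto F (𝓝[<] (Real.pi / p)) (𝓝 (number p (p - 1) k)) := by
    have := ((hP0.comp (tendsto_curve_right hp)).sub
      ((hQ0.comp (tendsto_curve_right hp)).const_mul p)).const_mul (1 / Real.pi)
    have e : 1 / Real.pi * (Real.pi * primitiveLimit (k * p + (p - 1)) (k + 1)
        - p * (Real.pi * primitiveLimit (k * p + (p - 1) - 1) k)) = number p (p - 1) k := by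
      rw [← primitiveLimit_sub_eq_number]
      have := Real.pi_pos
      field_simp
    rw [e] at this
    exact this
  have hlt := pi_div_pos hp
  have hnonneg : ∀ φ ∈ Ioo 0 (Real.pi / p), 0 ≤ f φ := fun φ h =>
    mul_nonneg (abs_nonneg _)
      (mul_nonneg (pow_nonneg (rho_pos hp h).le _) (paramDensity_pos hp h).le)
  -- A nonnegative derivative of a function with finite limits at both ends is integrable.
  have hint : IntegrableOn f (Ioc 0 (Real.pi / p)) := by
    have hFc : ContinuousOn F (Ioo 0 (Real.pi / p)) :=
      fun x hx => (hderiv x hx).continuousAt.continuousWithinAt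
    have hcont := continuousOn_Icc_extendFrom_Ioo hFc hl hr
    refine intervalIntegral.integrableOn_deriv_of_nonneg hcont (fun x hx => ?_) hnonneg
    refine (hderiv x hx).congr_of_eventuallyEq ?_
    filter_upwards [Ioo_mem_nhds hx.1 hx.2] with y hy
    exact extendFrom_extends hFc y hy
  refine ⟨hint.mono_set Ioo_subset_Ioc_self, ?_⟩
  rw [← integral_Ioc_eq_integral_Ioo, ← intervalIntegral.integral_of_le hlt.le,
    intervalIntegral.integral_eq_sub_of_hasDerivAt_of_tendsto hlt hderiv
      ((intervalIntegrable_iff_integrableOn_Ioc_of_le hlt.le).2 hint) hl hr, sub_zero]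

end Curve

/-! ### Uniqueness from moment growth -/

lemma hasSum_complexMGF_of_moment_le {μ : Measure ℝ} [IsProbabilityMeasure μ] {C : ℝ}
    (hint : ∀ k : ℕ, Integrable (fun x : ℝ => x ^ k) μ)
    (hC : ∀ k : ℕ, ∫ x, x ^ k ∂μ ≤ C ^ k) (z : ℂ) :
    HasSum (fun n : ℕ => z ^ n / (n.factorial : ℂ) * ((∫ x, x ^ n ∂μ : ℝ) : ℂ))
      (ProbabilityTheory.complexMGF id μ z) := by
  have hF : ∀ n : ℕ, Integrable
      (fun x : ℝ => z ^ n / (n.factorial : ℂ) * ((x ^ n : ℝ) : ℂ)) μ := fun n =>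
    (hint n).ofReal.const_mul _
  -- Absolute moments are reduced to even ones by `|x| ^ n ≤ 1 + x ^ (2 n)`, whence the factor `C ^
  -- 2`.
  have hnorm : ∀ n : ℕ, ∫ x, ‖z ^ n / (n.factorial : ℂ) * ((x ^ n : ℝ) : ℂ)‖ ∂μ
      ≤ ‖z‖ ^ n / n.factorial + (‖z‖ * C ^ 2) ^ n / n.factorial := by
    intro n
    calc ∫ x, ‖z ^ n / (n.factorial : ℂ) * ((x ^ n : ℝ) : ℂ)‖ ∂μ
        ≤ ∫ x, ‖z‖ ^ n / n.factorial * (1 + x ^ (2 * n)) ∂μ := by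
          refine integral_mono (hF n).norm
            (((integrable_const _).add (hint (2 * n))).const_mul _) fun x => ?_
          simp only [norm_mul, norm_div, norm_pow, Complex.norm_natCast, Complex.ofReal_pow,
            Complex.norm_real, Real.norm_eq_abs]
          refine mul_le_mul_of_nonneg_left ?_ (by positivity)
          rw [pow_mul, ← sq_abs x, ← pow_mul, mul_comm 2 n, pow_mul]
          nlinarith [sq_nonneg (|x| ^ n - 1)]
      _ = ‖z‖ ^ n / n.factorial * (1 + ∫ x, x ^ (2 * n) ∂μ) := by
          rw [integral_const_mul, integral_add (integrable_const _) (hint (2 * n))]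
          simp
      _ ≤ ‖z‖ ^ n / n.factorial * (1 + C ^ (2 * n)) := by
          gcongr
          exact hC _
      _ = _ := by rw [mul_pow, ← pow_mul]; ring
  have hsum : Summable fun n : ℕ => ∫ x, ‖z ^ n / (n.factorial : ℂ) * ((x ^ n : ℝ) : ℂ)‖ ∂μ :=
    Summable.of_nonneg_of_le (fun n => integral_nonneg fun x => norm_nonneg _) hnorm
      ((Real.summable_pow_div_factorial _).add (Real.summable_pow_div_factorial _))
  have h := hasSum_integral_of_summable_integral_norm hF hsum
  convert! h using 1
  · ext n
    rw [integral_const_mul, integral_complex_ofReal]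
  · rw [ProbabilityTheory.complexMGF]
    refine integral_congr_ae (ae_of_all _ fun x => ?_)
    rw [Complex.exp_eq_exp_ℂ, NormedSpace.exp_eq_tsum_div]
    refine tsum_congr fun n => ?_
    simp only [id]
    rw [mul_pow]
    push_cast
    ring

/-- A Fuss-Catalan distribution with exponentially bounded moments is unique. -/
lemma IsDistribution.eq_of_number_le {p r C : ℝ} (hC : ∀ k, number p r k ≤ C ^ k)
    {μ ν : Measure ℝ} (hμ : IsDistribution p r μ) (hν : IsDistribution p r ν) : μ = ν := by
  have := hμ.isProbabilityMeasure
  have := hν.isProbabilityMeasure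
  refine Measure.ext_of_complexMGF_id_eq (funext fun z => ?_)
  have h1 := hasSum_complexMGF_of_moment_le hμ.integrable_pow
    (fun k => (hμ.moment_eq k).trans_le (hC k)) z
  have h2 := hasSum_complexMGF_of_moment_le hν.integrable_pow
    (fun k => (hν.moment_eq k).trans_le (hC k)) z
  simp only [hμ.moment_eq] at h1
  simp only [hν.moment_eq] at h2
  exact h1.unique h2

/-! ### The density on the real line -/

/-- The density of `μ(p, p - 1)`. -/
noncomputable def density (p x : ℝ) : ℝ :=
  open Classical in
  if x ∈ Ioo 0 (rightEndpoint p) then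
    paramDensity p (Function.invFunOn (rho p) (Ioo 0 (Real.pi / p)) x)
  else 0

section Density

variable {p : ℝ}

lemma density_of_notMem {x : ℝ} (hx : x ∉ Ioo 0 (rightEndpoint p)) : density p x = 0 :=
  if_neg hx

lemma density_rho (hp : 1 < p) {φ : ℝ} (h : φ ∈ Ioo 0 (Real.pi / p)) :
    density p (rho p φ) = paramDensity p φ := by
  rw [density, if_pos (by rw [← rho_image hp]; exact mem_image_of_mem _ h),
    (rho_strictAntiOn hp).injOn.leftInvOn_invFunOn h]

lemma density_pos (hp : 1 < p) {x : ℝ} (hx : x ∈ Ioo 0 (rightEndpoint p)) : 0 < density p x := by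
  rw [← rho_image hp] at hx
  obtain ⟨φ, h, rfl⟩ := hx
  rw [density_rho hp h]
  exact paramDensity_pos hp h

lemma density_nonneg (hp : 1 < p) (x : ℝ) : 0 ≤ density p x := by
  by_cases hx : x ∈ Ioo 0 (rightEndpoint p)
  · exact (density_pos hp hx).le
  · rw [density_of_notMem hx]

lemma density_strictAntiOn (hp : 1 < p) :
    StrictAntiOn (density p) (Ioo 0 (rightEndpoint p)) := by
  rw [← rho_image hp]
  rintro _ ⟨a, ha, rfl⟩ _ ⟨b, hb, rfl⟩ hab
  rw [density_rho hp ha, density_rho hp hb]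
  exact paramDensity_strictMonoOn hp hb ha (((rho_strictAntiOn hp).lt_iff_gt ha hb).1 hab)

lemma density_antitoneOn (hp : 1 < p) : AntitoneOn (density p) (Ioi 0) := by
  intro x hx y hy hxy
  by_cases hy' : y < rightEndpoint p
  · exact (density_strictAntiOn hp).antitoneOn ⟨hx, hxy.trans_lt hy'⟩ ⟨hy, hy'⟩ hxy
  · rw [density_of_notMem (x := y) (fun h => hy' h.2)]
    exact density_nonneg hp x

lemma measurable_density (hp : 1 < p) : Measurable (density p) := by
  refine measurable_of_Ioi fun a => ?_
  rcases lt_or_ge a 0 with ha | ha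
  · have : density p ⁻¹' Ioi a = univ :=
      eq_univ_of_forall fun x => ha.trans_le (density_nonneg hp x)
    rw [this]
    exact MeasurableSet.univ
  -- For `a ≥ 0` the superlevel set lies in `(0, ∞)`, where the density is antitone, so it is an
  -- interval.
  · refine OrdConnected.measurableSet ⟨fun x hx y hy z hz => ?_⟩
    have hx0 : 0 < x := by
      by_contra h
      rw [mem_preimage, density_of_notMem (fun h' => h h'.1)] at hx
      exact absurd hx (not_lt.2 ha)
    exact lt_of_lt_of_le hy (density_antitoneOn hp (hx0.trans_le hz.1)
      (hx0.trans_le (hz.1.trans hz.2)) hz.2)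

/-- Change of variables `x = rho p φ` in the parametrized moments. -/
lemma integrable_pow_mul_density (hp : 1 < p) (k : ℕ) :
    Integrable (fun x => x ^ k * density p x) ∧
      ∫ x, x ^ k * density p x = number p (p - 1) k := by
  have hmoment := integral_param_moment hp k
  have hcongr : EqOn (fun φ => |rho p φ * rhoLogDeriv p φ| • (rho p φ ^ k * density p (rho p φ)))
      (fun φ => |rho p φ * rhoLogDeriv p φ| • (rho p φ ^ k * paramDensity p φ))
      (Ioo 0 (Real.pi / p)) := fun φ h => by
    simp only [density_rho hp h]
  have hd : ∀ φ ∈ Ioo 0 (Real.pi / p), HasDerivWithinAt (rho p)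
      (rho p φ * rhoLogDeriv p φ) (Ioo 0 (Real.pi / p)) φ :=
    fun φ h => (hasDerivAt_rho hp h).hasDerivWithinAt
  have hinj := (rho_strictAntiOn hp).injOn
  have hzero : ∀ x, x ∉ Ioo 0 (rightEndpoint p) → x ^ k * density p x = 0 := fun x hx => by
    rw [density_of_notMem hx, mul_zero]
  constructor
  · rw [← integrableOn_iff_integrable_of_support_subset (s := Ioo 0 (rightEndpoint p))
      (fun x hx => by by_contra h; exact hx (hzero x h)), ← rho_image hp,
      integrableOn_image_iff_integrableOn_abs_deriv_smul measurableSet_Ioo hd hinj,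
      integrableOn_congr_fun hcongr measurableSet_Ioo]
    exact hmoment.1
  · rw [← setIntegral_eq_integral_of_forall_compl_eq_zero (s := Ioo 0 (rightEndpoint p)) hzero,
      ← rho_image hp, integral_image_eq_integral_abs_deriv_smul measurableSet_Ioo hd hinj,
      setIntegral_congr_fun measurableSet_Ioo hcongr]
    exact hmoment.2

lemma number_le_rightEndpoint_pow (hp : 1 < p) (k : ℕ) :
    number p (p - 1) k ≤ rightEndpoint p ^ k := by
  have h0 := integrable_pow_mul_density hp 0
  have hk := integrable_pow_mul_density hp k
  simp only [pow_zero, one_mul] at h0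
  calc number p (p - 1) k = ∫ x, x ^ k * density p x := hk.2.symm
    _ ≤ ∫ x, rightEndpoint p ^ k * density p x := by
        refine integral_mono hk.1 (h0.1.const_mul _) fun x => ?_
        by_cases hx : x ∈ Ioo 0 (rightEndpoint p)
        · exact mul_le_mul_of_nonneg_right (pow_le_pow_left₀ hx.1.le hx.2.le k)
            (density_nonneg hp x)
        · simp [density_of_notMem hx]
    _ = rightEndpoint p ^ k := by
        rw [integral_const_mul, h0.2]; simp [number]

/-- The measure with density `density p`. -/
noncomputable def densityMeasure (p : ℝ) : Measure ℝ :=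
  volume.withDensity fun x => ENNReal.ofReal (density p x)

lemma lintegral_density (hp : 1 < p) : ∫⁻ x, ENNReal.ofReal (density p x) = 1 := by
  have h0 := integrable_pow_mul_density hp 0
  simp only [pow_zero, one_mul] at h0
  rw [← ofReal_integral_eq_lintegral_ofReal h0.1 (ae_of_all _ (density_nonneg hp)), h0.2]
  simp [number]

lemma isDistribution_densityMeasure (hp : 1 < p) :
    IsDistribution p (p - 1) (densityMeasure p) := by
  have hm : Measurable fun x => ENNReal.ofReal (density p x) :=
    (measurable_density hp).ennreal_ofReal
  have hlt : ∀ᵐ x : ℝ, ENNReal.ofReal (density p x) < ∞ := ae_of_all _ fun x => ENNReal.ofReal_lt_top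
  have heq : ∀ k : ℕ, (fun x : ℝ => (ENNReal.ofReal (density p x)).toReal • x ^ k)
      = fun x => x ^ k * density p x := fun k => funext fun x => by
    rw [ENNReal.toReal_ofReal (density_nonneg hp x), smul_eq_mul, mul_comm]
  refine ⟨⟨?_⟩, fun k => ?_, fun k => ?_⟩
  · rw [densityMeasure, withDensity_apply _ MeasurableSet.univ, Measure.restrict_univ,
      lintegral_density hp]
  · rw [densityMeasure, integrable_withDensity_iff_integrable_smul' hm hlt, heq]
    exact (integrable_pow_mul_density hp k).1
  · rw [densityMeasure, integral_withDensity_eq_integral_toReal_smul hm hlt, heq]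
    exact (integrable_pow_mul_density hp k).2

lemma rightEndpoint_pos (hp : 1 < p) : 0 < rightEndpoint p := by
  have : 0 < p - 1 := by linarith
  unfold rightEndpoint
  positivity

lemma isUnimodalWithMode_densityMeasure (hp : 1 < p) :
    IsUnimodalWithMode (densityMeasure p) 0 := by
  refine ⟨0, density p, density_nonneg hp, ?_, density_antitoneOn hp, by simp [densityMeasure]⟩
  intro x hx y hy _
  rw [density_of_notMem (fun h => lt_asymm h.1 hx), density_of_notMem (fun h => lt_asymm h.1 hy)]

end Density

end FussCatalan

/-! ### Uniqueness of the mode and the case `p = 1` -/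

lemma aemeasurable_of_monotoneOn_Iio_of_antitoneOn_Ioi {f : ℝ → ℝ} {a : ℝ}
    (h1 : MonotoneOn f (Iio a)) (h2 : AntitoneOn f (Ioi a)) : AEMeasurable f := by
  have e1 := aemeasurable_restrict_of_monotoneOn (μ := volume) measurableSet_Iio h1
  have e2 := aemeasurable_restrict_of_antitoneOn (μ := volume) measurableSet_Ioi h2
  rw [Measure.restrict_congr_set Iio_ae_eq_Iic] at e1
  have := aemeasurable_union_iff.2 ⟨e1, e2⟩
  rwa [Iic_union_Ioi, Measure.restrict_univ] at this

namespace FussCatalan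

/-- There is no atom, so any admissible `f` agrees almost everywhere with `density p`. If `a < 0`,
the upward jump from zero to positive values at `0` contradicts antitonicity beyond `a`; if `a > 0`,
the strict decrease just right of `0` contradicts monotonicity before `a`. -/
lemma mode_eq_zero_of_densityMeasure {p : ℝ} (hp : 1 < p) {a : ℝ}
    (h : IsUnimodalWithMode (densityMeasure p) a) : a = 0 := by
  obtain ⟨c, f, hf, hmono, hanti, hμ⟩ := h
  have hc : (c : ℝ≥0∞) = 0 := by
    have h1 := congrArg (fun μ : Measure ℝ => μ {a}) hμ
    simp only [densityMeasure, Measure.add_apply, Measure.smul_apply,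
      withDensity_absolutelyContinuous volume _ (Real.volume_singleton (a := a))] at h1
    simpa using h1.symm
  rw [hc, zero_smul, zero_add, densityMeasure, withDensity_eq_iff
    (measurable_density hp).ennreal_ofReal.aemeasurable
    (aemeasurable_of_monotoneOn_Iio_of_antitoneOn_Ioi hmono hanti).ennreal_ofReal
    (by rw [lintegral_density hp]; simp)] at hμ
  have hae : ∀ᵐ x : ℝ, density p x = f x := by
    filter_upwards [hμ] with x hx
    rwa [ENNReal.ofReal_eq_ofReal_iff (density_nonneg hp x) (hf x)] at hx
  -- Almost everywhere equality holds on a dense set, which supplies comparison points in any open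
  -- interval.
  have hdense := Measure.dense_of_ae hae
  have hE := rightEndpoint_pos hp
  rcases lt_trichotomy a 0 with ha | ha | ha
  · obtain ⟨x, hx, hax, hx0⟩ := hdense.exists_between ha
    obtain ⟨y, hy, hy0, hyE⟩ := hdense.exists_between hE
    have h1 := hanti hax (hax.trans (hx0.trans hy0)) (hx0.trans hy0).le
    rw [← show _ = _ from hx, ← show _ = _ from hy,
      density_of_notMem (fun h => lt_asymm h.1 hx0)] at h1
    exact absurd (density_pos hp ⟨hy0, hyE⟩) (not_lt.2 h1)
  · exact ha
  · have hm : 0 < min a (rightEndpoint p) := lt_min ha hE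
    obtain ⟨x, hx, hx0, hxm⟩ := hdense.exists_between (half_pos hm)
    obtain ⟨y, hy, hmy, hym⟩ := hdense.exists_between (half_lt_self hm)
    have hxy := hxm.trans hmy
    have hya := hym.trans_le (min_le_left _ _)
    have hyE := hym.trans_le (min_le_right _ _)
    have h1 := hmono (hxy.trans hya) hya hxy.le
    rw [← show _ = _ from hx, ← show _ = _ from hy] at h1
    exact absurd (density_strictAntiOn hp ⟨hx0, hxy.trans hyE⟩ ⟨hx0.trans hxy, hyE⟩ hxy)
      (not_lt.2 h1)

lemma number_one_zero (k : ℕ) : number 1 (1 - 1) k = 0 ^ k := by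
  rcases k with _ | k <;> simp [number]

lemma isDistribution_dirac_zero : IsDistribution 1 (1 - 1) (Measure.dirac 0) := by
  refine ⟨inferInstance, fun k => ?_, fun k => ?_⟩
  · exact integrable_dirac (by simp)
  · rw [integral_dirac, number_one_zero]

end FussCatalan

lemma isUnimodalWithMode_dirac_iff {a b : ℝ} :
    IsUnimodalWithMode (Measure.dirac b) a ↔ a = b := by
  constructor
  · rintro ⟨c, f, -, -, -, hμ⟩
    by_contra hab
    have h1 := congrArg (fun μ : Measure ℝ => μ {b}) hμ
    simp only [Measure.add_apply, Measure.smul_apply,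
      withDensity_absolutelyContinuous volume _ (Real.volume_singleton (a := b))] at h1
    simp [hab] at h1
  · rintro rfl
    exact ⟨1, fun _ => 0, fun _ => le_rfl, monotoneOn_const, antitoneOn_const, by simp⟩

theorem mainTheorem7 (p : ℝ) (hp : 1 ≤ p) :
    (∃! μ : Measure ℝ, FussCatalan.IsDistribution p (p - 1) μ) ∧
    ∀ μ : Measure ℝ, FussCatalan.IsDistribution p (p - 1) μ →
      IsUnimodal μ ∧
      (∀ a : ℝ, IsUnimodalWithMode μ a ↔ a = 0) ∧
      (1 < p →
        StrictAntiOn (FussCatalan.rho p) (Ioo 0 (Real.pi / p)) ∧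
        FussCatalan.rho p '' Ioo 0 (Real.pi / p) = Ioo 0 (FussCatalan.rightEndpoint p) ∧
        (∃ W : ℝ → ℝ,
          Measurable W ∧ (∀ x, 0 ≤ W x) ∧
          μ = volume.withDensity (fun x => ENNReal.ofReal (W x)) ∧
          (∀ x, x ∉ Ioo 0 (FussCatalan.rightEndpoint p) → W x = 0) ∧
          ∀ φ ∈ Ioo 0 (Real.pi / p),
            W (FussCatalan.rho p φ) =
              1 / (Real.pi * (Real.cot ((p - 1) * φ) + Real.cot φ))) ∧
        StrictMonoOn
          (fun φ : ℝ => 1 / (Real.pi * (Real.cot ((p - 1) * φ) + Real.cot φ)))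
          (Ioo 0 (Real.pi / p))) := by
  rcases hp.eq_or_lt with rfl | hp
  -- At `p = 1` the moments are `0 ^ k`, so the growth bound holds with `C = 0`.
  · have huniq : ∀ μ, FussCatalan.IsDistribution 1 (1 - 1) μ → μ = Measure.dirac 0 := fun μ hμ =>
      hμ.eq_of_number_le (fun k => (FussCatalan.number_one_zero k).le)
        FussCatalan.isDistribution_dirac_zero
    refine ⟨⟨_, FussCatalan.isDistribution_dirac_zero, huniq⟩, fun μ hμ => ?_⟩
    rw [huniq μ hμ]
    exact ⟨⟨0, isUnimodalWithMode_dirac_iff.2 rfl⟩, fun a => isUnimodalWithMode_dirac_iff,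
      fun h => absurd h (lt_irrefl _)⟩
  · have huniq : ∀ μ, FussCatalan.IsDistribution p (p - 1) μ → μ = FussCatalan.densityMeasure p :=
      fun μ hμ => hμ.eq_of_number_le (FussCatalan.number_le_rightEndpoint_pow hp)
        (FussCatalan.isDistribution_densityMeasure hp)
    have hmode := FussCatalan.isUnimodalWithMode_densityMeasure hp
    refine ⟨⟨_, FussCatalan.isDistribution_densityMeasure hp, huniq⟩, fun μ hμ => ?_⟩
    rw [huniq μ hμ]
    refine ⟨⟨0, hmode⟩, fun a => ⟨FussCatalan.mode_eq_zero_of_densityMeasure hp, ?_⟩,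
      fun _ => ⟨FussCatalan.rho_strictAntiOn hp, FussCatalan.rho_image hp,
        ⟨FussCatalan.density p, FussCatalan.measurable_density hp,
          FussCatalan.density_nonneg hp, rfl,
          fun x hx => FussCatalan.density_of_notMem hx,
          fun φ h => FussCatalan.density_rho hp h⟩,
        FussCatalan.paramDensity_strictMonoOn hp⟩⟩
    rintro rfl
    exact hmode
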